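/- For a measurable space $\mathbb X$ let $\mathcal B_{\mathsf{fin}}(\mathbb X)$ be the set of finite bags (multisets) over $\mathbb X$, equipped with the counting $\sigma$-algebra, which is generated by the sets $\{B : |B|_{S} = n\}$ with $S\subseteq\mathbb X$ measurable and $n\in\mathbb N$, where $|B|_S$ is the number of elements of $B$ in $S$, counted with multiplicity. An aggregator from $\mathbb A$ to $\mathbb B$ is a function $\Phi:\mathcal B_{\mathsf{fin}}(\mathbb A)\to\mathbb B$. A database schema consists of finitely many attribute names, finitely many relation symbols $R$, and for each $R$ a finite tuple $\mathrm{sort}(R)$ of pairwise distinct attribute names. Every attribute $A$ has a domain $\mathrm{dom}(A)$, a Polish space with its Borel $\sigma$-algebra. The $R$-tuples form the product of the domains of the attributes of $R$ (with the product $\sigma$-algebra), the facts $R(t)$ form the disjoint union of the spaces of $R$-tuples over all relation symbols $R$ (with the disjoint union $\sigma$-algebra), and database instances are finite bags of facts, with the counting $\sigma$-algebra. A query is a function from the instances over one schema to the instances over a schema with a single relation symbol; it is measurable if it is measurable with respect to the counting $\sigma$-algebras. Let $A_1,\dots,A_k$ be distinct attributes of $R$, let $A$ be an attribute of $R$, let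 $\mathbb B$ be a Polish space and let $\Phi$ be an aggregator from $\mathrm{dom}(A)$ to $\mathbb B$. For an instance $D$ and $a=(a_1,\dots,a_k)\in\prod_i\mathrm{dom}(A_i)$ let $\mathcal A_a(D)$ be the bag of the $A$-values of those $R$-tuples in $D$ (with multiplicity) whose values at $A_1,\dots,A_k$ are $a_1,\dots,a_k$. The group-by aggregate query $Q=\gamma_{A_1,\dots,A_k,\Phi(A)}(R)$ has one output relation symbol $R_Q$, with attribute domains $\mathrm{dom}(A_1),\dots,\mathrm{dom}(A_k),\mathbb B$, and is given by: the multiplicity of $R_Q(a_1,\dots,a_k,b)$ in $Q(D)$ is $1$ if $\mathcal A_a(D)$ is non-empty and $b=\Phi(\mathcal A_a(D))$, and $0$ otherwise. Then the following hold. 1. Let $\mathbb T,\mathbb S$ be standard Borel spaces and, for every $m\in\mathbb N$, let $\varphi_m:\mathbb T^m\to\mathbb S$ be measurable and symmetric (invariant under permutations of the arguments). Then there is an aggregator $\Phi$ from $\mathbb T$ to $\mathbb S$ with $\Phi(\{\!\{a_1,\dots,a_m\}\!\})=\varphi_m(a_1,\dots,a_m)$ for all $m$ and all $a_1,\dots,a_m\in\mathbb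 T$, and it is measurable with respect to the counting $\sigma$-algebra. 2. The query $\gamma_{A_1,\dots,A_k,\Phi(A)}(R)$ is measurable for each of the following aggregators $\Phi$ from $\mathrm{dom}(A)$ to a Polish space $\mathbb B$. In (b)–(d), $\nu:\mathrm{dom}(A)\to\mathbb B$ is any Borel map through which the attribute values are read in $\mathbb B$ (for example the identity of $\mathbb B=\mathrm{dom}(A)$, or the inclusion of $\mathrm{dom}(A)\subseteq\mathbb B=\mathbb R$). (a) Count, $\{\!\{a_1,\dots,a_m\}\!\}\mapsto m$, and distinct count, $\{\!\{a_1,\dots,a_m\}\!\}\mapsto|\{a_1,\dots,a_m\}|$, where the natural numbers are mapped to $\mathbb B$ by any fixed map $\mathbb N\to\mathbb B$ (for example $\mathbb B=\mathbb N$ or $\mathbb B=\mathbb R$). (b) Sum, $\{\!\{a_1,\dots,a_m\}\!\}\mapsto\nu(a_1)+\dots+\nu(a_m)$, if $\mathbb B$ is a commutative additive monoid with continuous addition. (c) Minimum and maximum, $\{\!\{a_1,\dots,a_m\}\!\}\mapsto\min_i\nu(a_i)$ and $\max_i\nu(a_i)$ for $m\ge1$, with an arbitrary value on the empty bag, if $\mathbb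 B$ is linearly ordered and $\{(x,y):x\le y\}$ is closed in $\mathbb B^2$. (d) Average, $\{\!\{a_1,\dots,a_m\}\!\}\mapsto\frac1m(\nu(a_1)+\dots+\nu(a_m))$ for $m\ge1$, with an arbitrary value on the empty bag, if $\mathbb B$ is a real vector space with continuous addition and continuous multiplication by each scalar. -/

import Mathlib

universe u v w

/-! ### Finite bags and the counting sigma-algebra -/

/-- The counting event of `S` and `n`: the finite bags that contain exactly `n` elements of `S`,
counted with multiplicity. -/
def countingEvent {X : Type*} (S : Set X) (n : ℕ) : Set (Multiset X) :=
  open Classical in {B | B.countP (· ∈ S) = n}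

/-- The counting sigma-algebra on the finite bags over a measurable space: the sigma-algebra
generated by the counting events of the measurable sets. -/
instance countingMeasurableSpace (X : Type*) [MeasurableSpace X] : MeasurableSpace (Multiset X) :=
  MeasurableSpace.generateFrom {E | ∃ (S : Set X) (n : ℕ), MeasurableSet S ∧ E = countingEvent S n}

/-! ### Schemas, sorted universes, facts and instances -/

/-- A database schema: finitely many attribute names, finitely many relation symbols, and for every
relation symbol `R` a finite tuple `sort R` of pairwise distinct attribute names. The tuple is
indexed by the columns of `R` (for `sort R = (A₁, …, Aₙ)` one takes `Col R = Fin n`). -/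
structure Schema where
  Attr : Type
  Rel : Type
  Col : Rel → Type
  [finiteAttr : Finite Attr]
  [finiteRel : Finite Rel]
  [finiteCol : ∀ R, Finite (Col R)]
  sort : ∀ R, Col R → Attr
  sort_injective : ∀ R, Function.Injective (sort R)

/-- A sorted universe over the attribute names of `τ`: every attribute has a domain, which is a
Polish space with its Borel sigma-algebra. -/
structure SortedUniverse (τ : Schema) where
  dom : τ.Attr → Type u
  [topology : ∀ A, TopologicalSpace (dom A)]
  [polish : ∀ A, PolishSpace (dom A)]
  [measurable : ∀ A, MeasurableSpace (dom A)]
  [borel : ∀ A, BorelSpace (dom A)]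

attribute [instance] Schema.finiteAttr Schema.finiteRel Schema.finiteCol
  SortedUniverse.topology SortedUniverse.polish SortedUniverse.measurable SortedUniverse.borel

/-- The `R`-tuples: the product of the domains of the attributes of `R`. Its sigma-algebra is the
product sigma-algebra (`MeasurableSpace.pi`). -/
abbrev RTuple {τ : Schema} (U : SortedUniverse.{u} τ) (R : τ.Rel) : Type u :=
  ∀ c : τ.Col R, U.dom (τ.sort R c)

/-- The facts `R(t)`: the disjoint union over the relation symbols `R` of the spaces of `R`-tuples,
with the disjoint union sigma-algebra (`Sigma.instMeasurableSpace`). -/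
abbrev DBFact {τ : Schema} (U : SortedUniverse.{u} τ) : Type u :=
  Σ R : τ.Rel, RTuple U R

/-- The database instances: finite bags of facts, with the counting sigma-algebra. -/
abbrev DBInstance {τ : Schema} (U : SortedUniverse.{u} τ) : Type u :=
  Multiset (DBFact U)

/-! ### Aggregators -/

/-- An aggregator from `A` to `B` is a function from the finite bags over `A` to `B`. -/
abbrev Aggregator (A : Type v) (B : Type w) : Type (max v w) := Multiset A → B

/-- Count, as an element of a domain `B` into which the natural numbers are mapped. -/
def countAgg (A : Type v) (B : Type w) [NatCast B] : Aggregator A B :=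
  fun s => (s.card : B)

/-- Distinct count, as an element of a domain `B` into which the natural numbers are mapped. -/
noncomputable def distinctCountAgg (A : Type v) (B : Type w) [NatCast B] : Aggregator A B :=
  open Classical in fun s => (s.toFinset.card : B)

/-- Sum. -/
def sumAgg (M : Type v) [AddCommMonoid M] : Aggregator M M :=
  fun s => s.sum

/-- Minimum, with value `e` on the empty bag. -/
def minAgg (M : Type v) [LinearOrder M] (e : M) : Aggregator M M :=
  fun s => if h : s.toFinset.Nonempty then s.toFinset.min' h else e

/-- Maximum, with value `e` on the empty bag. -/
def maxAgg (M : Type v) [LinearOrder M] (e : M) : Aggregator M M :=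
  fun s => if h : s.toFinset.Nonempty then s.toFinset.max' h else e

/-- Average, with value `e` on the empty bag. -/
noncomputable def avgAgg (M : Type v) [AddCommMonoid M] [Module ℝ M] (e : M) : Aggregator M M :=
  open Classical in fun s => if s = 0 then e else (s.card : ℝ)⁻¹ • s.sum

/-! ### Group-by aggregate queries -/

section GroupBy

variable {τ : Schema} (U : SortedUniverse.{u} τ) (R : τ.Rel) {k : ℕ} (G : Fin k ↪ τ.Col R)

/-- The output schema of a group-by aggregate query: one relation symbol, whose attributes are the
grouping attributes `A₁, …, Aₖ` of `R` (columns `some i`) followed by a new attribute for the value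
of the aggregate (column `none`). -/
def groupSchema : Schema where
  Attr := Option τ.Attr
  Rel := Unit
  Col := fun _ => Option (Fin k)
  sort := fun _ => Option.map fun i => τ.sort R (G i)
  sort_injective := fun _ =>
    Option.map_injective ((τ.sort_injective R).comp G.injective)

/-- The domains of the output attributes: those of the old attributes are unchanged, that of the
new attribute is `B`. -/
def groupDom (B : Type u) : Option τ.Attr → Type u
  | none => B
  | some A => U.dom A

/-- The output universe of a group-by aggregate query with an aggregator with values in `B`. -/
def groupUniverse (B : Type u) [TopologicalSpace B] [PolishSpace B] [MeasurableSpace B]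
    [BorelSpace B] : SortedUniverse.{u} (groupSchema R G) where
  dom := groupDom U B
  topology
    | none => inferInstanceAs (TopologicalSpace B)
    | some A => inferInstanceAs (TopologicalSpace (U.dom A))
  polish
    | none => inferInstanceAs (PolishSpace B)
    | some A => inferInstanceAs (PolishSpace (U.dom A))
  measurable
    | none => inferInstanceAs (MeasurableSpace B)
    | some A => inferInstanceAs (MeasurableSpace (U.dom A))
  borel
    | none => inferInstanceAs (BorelSpace B)
    | some A => inferInstanceAs (BorelSpace (U.dom A))

/-- The values of the grouping attributes. -/
abbrev GroupKey : Type u := ∀ i : Fin k, U.dom (τ.sort R (G i))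

/-- The values `(a₁, …, aₖ)` of the grouping attributes in an `R`-tuple. -/
def groupKey (t : RTuple U R) : GroupKey U R G := fun i => t (G i)

/-- The output fact `R_Q(a₁, …, aₖ, b)`. -/
def groupFact (B : Type u) [TopologicalSpace B] [PolishSpace B] [MeasurableSpace B]
    [BorelSpace B] (a : GroupKey U R G) (b : B) : DBFact (groupUniverse U R G B) :=
  ⟨(), fun c => match c with
    | none => b
    | some i => a i⟩

/-- The bag of `R`-tuples of an instance. -/
noncomputable def tuplesOf (D : DBInstance U) : Multiset (RTuple U R) :=
  open Classical in D.filterMap fun f => if h : f.1 = R then some (h ▸ f.2) else none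

/-- The bag of values in column `j` of those `R`-tuples of `D` whose grouping attributes have the
values `a`: select, then project. -/
noncomputable def groupBag (j : τ.Col R) (a : GroupKey U R G) (D : DBInstance U) :
    Multiset (U.dom (τ.sort R j)) :=
  open Classical in ((tuplesOf U R D).filter fun t => groupKey U R G t = a).map fun t => t j

/-- The group-by aggregate query: for every value `a = (a₁, …, aₖ)` of the grouping attributes that
occurs in `R`, the output contains the fact `R_Q(a₁, …, aₖ, Φ(bag of the group of a))` once. -/
noncomputable def groupAggQuery (j : τ.Col R) {B : Type u} [TopologicalSpace B] [PolishSpace B]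
    [MeasurableSpace B] [BorelSpace B] (Φ : Aggregator (U.dom (τ.sort R j)) B) :
    DBInstance U → DBInstance (groupUniverse U R G B) :=
  open Classical in fun D =>
    ((tuplesOf U R D).map (groupKey U R G)).dedup.map fun a =>
      groupFact U R G B a (Φ (groupBag U R G j a D))

open Classical in
theorem count_tuplesOf (D : DBInstance U) (t : RTuple U R) :
    (tuplesOf U R D).count t = D.count ⟨R, t⟩ := by
  induction D using Multiset.induction_on with
  | empty => simp [tuplesOf]
  | cons f D ih =>
    obtain ⟨R', t'⟩ := f
    unfold tuplesOf at ih ⊢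
    by_cases h : R' = R
    · subst h
      rw [Multiset.filterMap_cons_some _ _ _ (b := t') (by simp), Multiset.count_cons, ih,
        Multiset.count_cons]
      simp
    · rw [Multiset.filterMap_cons_none _ _ (by simp [h]), ih, Multiset.count_cons_of_ne]
      intro e
      exact h (congrArg Sigma.fst e).symm

open Classical in
/-- The multiplicity of a value in the bag of a group. -/
theorem count_groupBag (j : τ.Col R) (a : GroupKey U R G) (D : DBInstance U)
    (x : U.dom (τ.sort R j)) :
    (groupBag U R G j a D).count x
      = (tuplesOf U R D).countP fun t => groupKey U R G t = a ∧ t j = x := by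
  unfold groupBag
  rw [Multiset.count_map, Multiset.filter_filter, Multiset.countP_eq_card_filter]
  congr 1
  apply Multiset.filter_congr
  intro t _
  constructor
  · rintro ⟨h1, h2⟩; exact ⟨h2, h1.symm⟩
  · rintro ⟨h1, h2⟩; exact ⟨h2.symm, h1⟩

open Classical in
/-- The multiplicities in the output of a group-by aggregate query. -/
theorem count_groupAggQuery (j : τ.Col R) {B : Type u} [TopologicalSpace B] [PolishSpace B]
    [MeasurableSpace B] [BorelSpace B] (Φ : Aggregator (U.dom (τ.sort R j)) B)
    (D : DBInstance U) (a : GroupKey U R G) (b : B) :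
    (groupAggQuery U R G j Φ D).count (groupFact U R G B a b)
      = if groupBag U R G j a D ≠ 0 ∧ b = Φ (groupBag U R G j a D) then 1 else 0 := by
  have hinj : ∀ (a a' : GroupKey U R G) (b b' : B),
      groupFact U R G B a b = groupFact U R G B a' b' → a = a' ∧ b = b' := by
    intro a a' b b' h
    have h2 := eq_of_heq (Sigma.mk.inj h).2
    exact ⟨funext fun i => congrFun h2 (some i), congrFun h2 none⟩
  have hne : groupBag U R G j a D ≠ 0 ↔ a ∈ (tuplesOf U R D).map (groupKey U R G) := by
    unfold groupBag
    rw [Ne, Multiset.map_eq_zero, Multiset.filter_eq_nil, Multiset.mem_map]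
    push Not
    rfl
  have hnd : (groupAggQuery U R G j Φ D).Nodup := by
    refine (Multiset.nodup_dedup _).map ?_
    intro a a' h
    exact (hinj _ _ _ _ h).1
  rw [Multiset.count_eq_of_nodup hnd]
  refine if_congr (Iff.trans ?_ (and_congr_left' hne.symm)) rfl rfl
  unfold groupAggQuery
  rw [Multiset.mem_map]
  constructor
  · rintro ⟨a', h1, h2⟩
    obtain ⟨rfl, rfl⟩ := hinj _ _ _ _ h2
    exact ⟨Multiset.mem_dedup.1 h1, rfl⟩
  · rintro ⟨h1, rfl⟩
    exact ⟨a, Multiset.mem_dedup.2 h1, rfl⟩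

end GroupBy

/-! ### Measurability on finite bags -/

section CountingMeasurable

variable {Ω X Y : Type*} [MeasurableSpace Ω] [MeasurableSpace X] [MeasurableSpace Y]

/-! Measurability of a map on bags reduces to measurability on each power `X^m`. A standard Borel
`X` embeds measurably in ℝ, where a bag can be sorted. Its `i`-th entry is at most `x` exactly when
more than `i` elements lie in `(-∞, x]`, a condition on counts, so sorting is counting-measurable.
Pulling back to `X` gives a measurable enumeration of the bags of each cardinality
(`exists_measurable_enumeration`), and the countably many cardinalities are glued in
`measurable_of_measurable_ofFn`. This settles symmetric functions at once. For a group-by query, the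
instance is cut down to its `R`-tuples, which may then be taken as `t₁, …, tₘ`. The output has one
fact for each index where a key occurs first. That event is measurable because the diagonal is, and
the fact depends measurably on the tuples, so `measurable_multiset_map_filter_univ` applies. It
remains to check that each aggregator is measurable, again on fixed-length tuples. -/

open Classical in
theorem measurable_multiset_countP {S : Set X} (hS : MeasurableSet S) :
    Measurable fun B : Multiset X => B.countP (· ∈ S) := by
  refine measurable_to_countable' fun n => ?_
  exact MeasurableSpace.measurableSet_generateFrom ⟨S, n, hS, rfl⟩

open Classical in
theorem measurable_multiset_of_countP {f : Ω → Multiset X}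
    (h : ∀ S : Set X, MeasurableSet S → Measurable fun ω => (f ω).countP (· ∈ S)) :
    Measurable f := by
  refine measurable_generateFrom ?_
  rintro _ ⟨S, n, hS, rfl⟩
  exact h S hS (measurableSet_singleton n)

theorem measurable_multiset_card : Measurable (Multiset.card : Multiset X → ℕ) := by
  classical
  have h := measurable_multiset_countP (X := X) MeasurableSet.univ
  simpa using h

/-- Finitely many measurable elements, each present on a measurable event, form a measurable bag. -/
theorem measurable_multiset_map_filter_univ {ι : Type*} [Fintype ι] {p : ι → Ω → Prop}
    [∀ ω, DecidablePred fun i => p i ω] {f : ι → Ω → X}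
    (hp : ∀ i, MeasurableSet {ω | p i ω}) (hf : ∀ i, Measurable (f i)) :
    Measurable fun ω => (Finset.univ.filter fun i => p i ω).val.map fun i => f i ω := by
  classical
  refine measurable_multiset_of_countP fun S hS => ?_
  -- The count in `S` is a finite sum of indicators of measurable events.
  have h : ∀ ω, ((Finset.univ.filter fun i => p i ω).val.map fun i => f i ω).countP (· ∈ S)
      = ∑ i, if p i ω ∧ f i ω ∈ S then 1 else 0 := by
    intro ω
    rw [Multiset.countP_map, ← Finset.filter_val, Finset.filter_filter, Finset.card_val,
      Finset.card_filter]
  simp_rw [h]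
  exact Finset.measurable_sum _ fun i _ =>
    Measurable.ite ((hp i).inter (hf i hS)) measurable_const measurable_const

/-- In a sorted list the entries `≤ x` form an initial segment, whose length is their count; the
inequality is strict because indices start at 0. -/
theorem List.getD_le_iff_lt_countP {l : List ℝ} (hl : l.Pairwise (· ≤ ·)) {i : ℕ}
    (hi : i < l.length) (x : ℝ) : l.getD i 0 ≤ x ↔ i < l.countP (· ≤ x) := by
  induction l generalizing i with
  | nil => simp at hi
  | cons a l ih =>
    rw [List.pairwise_cons] at hl
    by_cases ha : a ≤ x
    · rw [List.countP_cons_of_pos (by simpa using ha)]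
      cases i with
      | zero => simpa using ha
      | succ i => simpa using ih hl.2 (by simpa using hi)
    · have h0 : ∀ b ∈ a :: l, ¬ b ≤ x := by
        intro b hb h
        rcases List.mem_cons.1 hb with rfl | hb
        · exact ha h
        · exact ha ((hl.1 b hb).trans h)
      have h1 : (a :: l).countP (· ≤ x) = 0 := by
        rw [List.countP_eq_zero]
        simpa using h0
      rw [h1, List.getD_eq_getElem _ _ hi]
      simpa using h0 _ (List.getElem_mem hi)

/-- The order statistics of a finite bag of reals are measurable. -/
theorem measurable_sort_getD (i : ℕ) :
    Measurable fun B : Multiset ℝ => (B.sort (· ≤ ·)).getD i 0 := by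
  classical
  refine measurable_of_Iic fun x => ?_
  -- The second set accounts for the default 0 returned when the bag has too few elements.
  have h : (fun B : Multiset ℝ => (B.sort (· ≤ ·)).getD i 0) ⁻¹' Set.Iic x
      = {B | i < B.card ∧ i < B.countP (· ∈ Set.Iic x)} ∪ {B | B.card ≤ i ∧ 0 ≤ x} := by
    ext B
    simp only [Set.mem_preimage, Set.mem_Iic, Set.mem_union, Set.mem_ofPred_eq]
    rcases lt_or_ge i B.card with hi | hi
    · rw [List.getD_le_iff_lt_countP (Multiset.pairwise_sort B _) (by simpa using hi),
        ← Multiset.coe_countP, Multiset.sort_eq]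
      simp [hi, hi.not_ge]
    · rw [List.getD_eq_default _ _ (by simpa using hi)]
      simp [hi, hi.not_gt]
  rw [h]
  have hc := measurable_multiset_card (X := ℝ)
  have hx := measurable_multiset_countP (measurableSet_Iic (a := x))
  exact ((measurableSet_lt measurable_const hc).inter
    (measurableSet_lt measurable_const hx)).union
    ((measurableSet_le hc measurable_const).inter (MeasurableSet.const _))

theorem measurable_multiset_map {f : X → Y} (hf : Measurable f) :
    Measurable (Multiset.map f) := by
  classical
  refine measurable_multiset_of_countP fun S hS => ?_
  have h := measurable_multiset_countP (hf hS)
  simpa only [Multiset.countP_map, ← Multiset.countP_eq_card_filter, Set.mem_preimage] using h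

/-- The elements of a finite bag over a standard Borel space can be enumerated measurably. -/
theorem exists_measurable_enumeration [StandardBorelSpace X] [Nonempty X] (m : ℕ) :
    ∃ σ : Multiset X → Fin m → X, Measurable σ ∧
      ∀ B : Multiset X, B.card = m → (List.ofFn (σ B) : Multiset X) = B := by
  obtain ⟨e, he⟩ := MeasureTheory.exists_measurableEmbedding_real X
  -- `g` is a measurable left inverse of `e`, defined on all of ℝ; it brings the sorted values back
  -- to `X`.
  obtain ⟨g, hg, hge⟩ := he.exists_measurable_extend measurable_id fun _ => ‹Nonempty X›
  refine ⟨fun B i => g (((B.map e).sort (· ≤ ·)).getD i 0), ?_, ?_⟩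
  · exact measurable_pi_lambda _ fun i =>
      hg.comp ((measurable_sort_getD i).comp (measurable_multiset_map he.measurable))
  · rintro B rfl
    have h : List.ofFn (fun i : Fin B.card => g (((B.map e).sort (· ≤ ·)).getD i 0))
        = ((B.map e).sort (· ≤ ·)).map g := by
      apply List.ext_getElem
      · simp
      · intro i h1 h2
        rw [List.getElem_ofFn, List.getElem_map, List.getD_eq_getElem]
    rw [h, ← Multiset.map_coe, Multiset.sort_eq, Multiset.map_map, hge, Multiset.map_id]

/-- A function of finite bags over a standard Borel space is measurable if it is a measurable
function of every enumeration. -/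
theorem measurable_of_measurable_ofFn [StandardBorelSpace X] {f : Multiset X → Y}
    (h : ∀ m, Measurable fun t : Fin m → X => f (List.ofFn t)) : Measurable f := by
  -- The enumeration needs a point of `X`; over an empty `X` the only bag is the empty one.
  cases isEmpty_or_nonempty X
  · have : f = fun _ => f 0 := funext fun B => by
      rw [Multiset.eq_zero_of_forall_notMem (s := B) fun a => isEmptyElim a]
    rw [this]
    exact measurable_const
  choose σ hσ hσB using exists_measurable_enumeration (X := X)
  intro s hs
  have : f ⁻¹' s = ⋃ m, {B | B.card = m} ∩ {B | f (List.ofFn (σ m B)) ∈ s} := by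
    ext B
    simp only [Set.mem_preimage, Set.mem_iUnion, Set.mem_inter_iff, Set.mem_ofPred_eq]
    constructor
    · intro hB
      exact ⟨_, rfl, by rwa [hσB _ B rfl]⟩
    · rintro ⟨m, hm, hB⟩
      rwa [hσB m B hm] at hB
  rw [this]
  exact MeasurableSet.iUnion fun m =>
    (measurable_multiset_card (measurableSet_singleton m)).inter ((h m).comp (hσ m) hs)

/-- Each value is represented by the least index where it occurs. This replaces `dedup` by a
selection of indices, whose events can be checked for measurability one by one. -/
theorem Multiset.dedup_ofFn {α : Type*} [DecidableEq α] {m : ℕ} (t : Fin m → α)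
    [DecidablePred fun i => ∀ l < i, t l ≠ t i] :
    (List.ofFn t : Multiset α).dedup
      = (Finset.univ.filter fun i => ∀ l < i, t l ≠ t i).val.map t := by
  refine (Multiset.Nodup.ext (Multiset.nodup_dedup _) ?_).2 fun a => ?_
  · refine Multiset.Nodup.map_on ?_ (Finset.nodup _)
    intro i hi l hl h
    simp only [Finset.mem_val, Finset.mem_filter, Finset.mem_univ, true_and] at hi hl
    rcases lt_trichotomy i l with hil | hil | hil
    · exact absurd h (hl i hil)
    · exact hil
    · exact absurd h.symm (hi l hil)
  · simp only [Multiset.mem_dedup, Multiset.mem_coe, List.mem_ofFn, Multiset.mem_map,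
      Finset.mem_val, Finset.mem_filter, Finset.mem_univ, true_and]
    constructor
    · intro h
      obtain ⟨i, hi, hmin⟩ := WellFounded.has_min (wellFounded_lt (α := Fin m)) {i | t i = a} h
      exact ⟨i, fun l hl hli => hmin l (hli.trans hi) hl, hi⟩
    · rintro ⟨i, -, hi⟩
      exact ⟨i, hi⟩

theorem measurableSet_first_occurrence [MeasurableEq X] {m : ℕ} {t : Fin m → Ω → X}
    (ht : ∀ i, Measurable (t i)) (i : Fin m) :
    MeasurableSet {ω | ∀ l < i, t l ω ≠ t i ω} := by
  simp only [Set.ofPred_forall]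
  exact MeasurableSet.iInter fun l => MeasurableSet.iInter fun _ =>
    (measurableSet_eq_fun (ht l) (ht i)).compl

end CountingMeasurable

/-! ### Bags and tuples of fixed length -/

/-- An aggregator given by symmetric functions of the elements. -/
theorem exists_aggregator_of_symmetric {T S : Type*} (φ : ∀ m : ℕ, (Fin m → T) → S)
    (hφ : ∀ m (t : Fin m → T) (π : Equiv.Perm (Fin m)), φ m (t ∘ π) = φ m t) :
    ∃ Φ : Aggregator T S, ∀ m (t : Fin m → T), Φ (Multiset.ofList (List.ofFn t)) = φ m t := by
  classical
  -- Any linear order will do: tuples with the same bag have the same sorted rearrangement, which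
  -- turns a permutation of lists into permutations of indices.
  let _ : LinearOrder T := linearOrderOfSTO WellOrderingRel
  have hperm : ∀ (m n : ℕ) (s : Fin m → T) (t : Fin n → T),
      (List.ofFn s).Perm (List.ofFn t) → φ m s = φ n t := by
    intro m n s t h
    obtain rfl : m = n := by simpa using h.length_eq
    have h' : s ∘ Tuple.sort s = t ∘ Tuple.sort t := List.ofFn_injective <|
      (((Tuple.sort s).ofFn_comp_perm s).trans
        (h.trans ((Tuple.sort t).ofFn_comp_perm t).symm)).eq_of_pairwise'
        (Tuple.monotone_sort s).sortedLE_ofFn.pairwise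
        (Tuple.monotone_sort t).sortedLE_ofFn.pairwise
    rw [← hφ m s (Tuple.sort s), h', hφ]
  refine ⟨fun B => φ B.toList.length B.toList.get, fun m t => hperm _ _ _ _ ?_⟩
  rw [List.ofFn_get, ← Multiset.coe_eq_coe, Multiset.coe_toList]

theorem measurable_multiset_ofFn {X : Type*} [MeasurableSpace X] (m : ℕ) :
    Measurable fun t : Fin m → X => (List.ofFn t : Multiset X) := by
  classical
  have h := measurable_multiset_map_filter_univ (p := fun (_ : Fin m) (_ : Fin m → X) => True)
    (f := fun i t => t i) (fun _ => MeasurableSet.univ) measurable_pi_apply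
  simpa [Fin.univ_val_map] using h

/-! ### Group-by queries -/

section GroupByMeasurable

variable {τ : Schema} (U : SortedUniverse.{u} τ) (R : τ.Rel) {k : ℕ} (G : Fin k ↪ τ.Col R)

theorem measurable_tuplesOf : Measurable (tuplesOf U R) := by
  classical
  refine measurable_multiset_of_countP fun S hS => ?_
  -- Counting `R`-tuples in `S` is counting facts in the image of `S`, measurable because its trace
  -- on every other relation symbol is empty.
  have hS' : MeasurableSet (Sigma.mk R '' S : Set (DBFact U)) := by
    refine MeasurableSpace.measurableSet_iInf.2 fun R' => ?_
    change MeasurableSet (Sigma.mk R' ⁻¹' (Sigma.mk R '' S))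
    by_cases h : R' = R
    · subst h
      rwa [Set.preimage_image_eq _ sigma_mk_injective]
    · rw [Set.preimage_image_sigmaMk_of_ne h]
      exact MeasurableSet.empty
  have h : ∀ D : DBInstance U, (tuplesOf U R D).countP (· ∈ S)
      = D.countP (· ∈ (Sigma.mk R '' S : Set (DBFact U))) := by
    intro D
    unfold tuplesOf
    induction D using Multiset.induction_on with
    | empty => simp
    | cons f D ih =>
      obtain ⟨R', t⟩ := f
      by_cases h : R' = R
      · subst h
        rw [Multiset.filterMap_cons_some _ _ _ (b := t) (by simp), Multiset.countP_cons, ih,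
          Multiset.countP_cons]
        simp
      · rw [Multiset.filterMap_cons_none _ _ (by simp [h]), ih, Multiset.countP_cons_of_neg]
        rintro ⟨t', -, e⟩
        exact h (congrArg Sigma.fst e).symm
  simp_rw [h]
  exact measurable_multiset_countP hS'

theorem measurable_groupKey : Measurable (groupKey U R G) :=
  measurable_pi_lambda _ fun i => measurable_pi_apply (G i)

theorem measurable_groupFact (B : Type u) [TopologicalSpace B] [PolishSpace B]
    [MeasurableSpace B] [BorelSpace B] :
    Measurable fun p : GroupKey U R G × B => groupFact U R G B p.1 p.2 := by
  have hmk : Measurable fun t : RTuple (groupUniverse U R G B) () =>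
      (⟨(), t⟩ : DBFact (groupUniverse U R G B)) :=
    fun s hs => MeasurableSpace.measurableSet_iInf.1 hs ()
  refine hmk.comp (measurable_pi_lambda _ fun c => ?_)
  cases c with
  | none => exact measurable_snd
  | some i => exact (measurable_pi_apply i).comp measurable_fst

/-- A group-by aggregate query with a measurable aggregator is measurable. -/
theorem measurable_groupAggQuery (j : τ.Col R) {B : Type u} [TopologicalSpace B] [PolishSpace B]
    [MeasurableSpace B] [BorelSpace B] {Φ : Aggregator (U.dom (τ.sort R j)) B}
    (hΦ : Measurable Φ) : Measurable (groupAggQuery U R G j Φ) := by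
  classical
  -- The query factors through the bag of `R`-tuples, which live in one standard Borel product
  -- space.
  let q : Multiset (RTuple U R) → DBInstance (groupUniverse U R G B) := fun M =>
    (M.map (groupKey U R G)).dedup.map fun a =>
      groupFact U R G B a (Φ ((M.filter fun t => groupKey U R G t = a).map fun t => t j))
  have hq : Measurable q := by
    refine measurable_of_measurable_ofFn fun m => ?_
    have hkey : ∀ i, Measurable fun t : Fin m → RTuple U R => groupKey U R G (t i) :=
      fun i => (measurable_groupKey U R G).comp (measurable_pi_apply i)
    have hbag : ∀ i, Measurable fun t : Fin m → RTuple U R =>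
        ((Finset.univ.filter fun l => groupKey U R G (t l) = groupKey U R G (t i)).val.map
          fun l => t l j) := fun i =>
      measurable_multiset_map_filter_univ (f := fun l t => t l j)
        (fun l => measurableSet_eq_fun (hkey l) (hkey i))
        fun l => (measurable_pi_apply j).comp (measurable_pi_apply l)
    have h := measurable_multiset_map_filter_univ (measurableSet_first_occurrence hkey)
      fun i => (measurable_groupFact U R G B).comp ((hkey i).prodMk (hΦ.comp (hbag i)))
    convert h using 2 with t
    simp only [q]
    rw [Multiset.map_coe, List.map_ofFn]
    change Multiset.map _ (Multiset.dedup
      (Multiset.ofList (List.ofFn fun i => groupKey U R G (t i)))) = _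
    rw [Multiset.dedup_ofFn, Multiset.map_map]
    refine Multiset.map_congr rfl fun i _ => ?_
    simp only [Function.comp_apply]
    rw [← Fin.univ_val_map, Multiset.filter_map, Multiset.map_map]
    rfl
  exact hq.comp (measurable_tuplesOf U R)

end GroupByMeasurable

/-! ### The individual aggregators -/

section Aggregators

variable {X B : Type*} [MeasurableSpace X] [MeasurableSpace B]

theorem measurable_countAgg [NatCast B] : Measurable (countAgg X B) :=
  (measurable_from_top (f := (Nat.cast : ℕ → B))).comp measurable_multiset_card

theorem measurable_distinctCountAgg [StandardBorelSpace X] [NatCast B] :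
    Measurable (distinctCountAgg X B) := by
  classical
  refine measurable_of_measurable_ofFn fun m => ?_
  have h := measurable_multiset_map_filter_univ
    (measurableSet_first_occurrence fun i : Fin m => measurable_pi_apply (X := fun _ => X) i)
    fun i => measurable_pi_apply (X := fun _ => X) i
  convert (measurable_from_top (f := (Nat.cast : ℕ → B))).comp
    (measurable_multiset_card.comp h) using 2 with t
  have hd : (Multiset.ofList (List.ofFn t)).toFinset.val = _ := Multiset.dedup_ofFn t
  simp only [distinctCountAgg, Finset.card, Function.comp_apply]
  convert congrArg (fun s : Multiset X => (s.card : B)) hd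

theorem measurable_multiset_sum_map [StandardBorelSpace X] [AddCommMonoid B] [MeasurableAdd₂ B]
    {ν : X → B} (hν : Measurable ν) : Measurable fun s : Multiset X => (s.map ν).sum := by
  refine measurable_of_measurable_ofFn fun m => ?_
  simp only [Multiset.map_coe, Multiset.sum_coe, List.map_ofFn, List.sum_ofFn]
  exact Finset.measurable_sum _ fun i _ => hν.comp (measurable_pi_apply i)

theorem measurable_maxAgg [StandardBorelSpace X] [LinearOrder B] [MeasurableSup₂ B]
    {ν : X → B} (hν : Measurable ν) (e : B) :
    Measurable fun s : Multiset X => maxAgg B e (s.map ν) := by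
  classical
  refine measurable_of_measurable_ofFn fun m => ?_
  cases m with
  -- There is only one tuple of length 0, so the value `e` plays no role.
  | zero => exact Subsingleton.measurable
  | succ m =>
    have h := Finset.measurable_sup' (Finset.univ_nonempty (α := Fin (m + 1)))
      fun i _ => hν.comp (measurable_pi_apply (X := fun _ => X) i)
    convert h using 2 with t
    have he : ((Multiset.ofList (List.ofFn t)).map ν).toFinset
        = Finset.univ.image fun i => ν (t i) := by
      ext; simp only [Multiset.map_coe, List.map_ofFn]; simp [-List.ofFn_succ]
    rw [maxAgg, dif_pos (by simp), Finset.sup'_apply]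
    simp_rw [he]
    rw [Finset.max'_eq_sup', Finset.sup'_image]
    rfl

theorem measurable_minAgg [StandardBorelSpace X] [LinearOrder B] [MeasurableInf₂ B]
    {ν : X → B} (hν : Measurable ν) (e : B) :
    Measurable fun s : Multiset X => minAgg B e (s.map ν) :=
  -- The minimum is the maximum for the reversed order.
  measurable_maxAgg (B := Bᵒᵈ) hν e

theorem measurable_avgAgg [StandardBorelSpace X] [AddCommMonoid B] [Module ℝ B]
    [MeasurableAdd₂ B] [MeasurableConstSMul ℝ B] {ν : X → B} (hν : Measurable ν) (e : B) :
    Measurable fun s : Multiset X => avgAgg B e (s.map ν) := by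
  refine measurable_of_measurable_ofFn fun m => ?_
  cases m with
  | zero => exact Subsingleton.measurable
  | succ m =>
    -- At fixed length the factor `1/(m+1)` is constant, so continuity in the scalar is not needed.
    have h := ((measurable_multiset_sum_map hν).comp
      (measurable_multiset_ofFn (X := X) (m + 1))).const_smul ((m + 1 : ℕ) : ℝ)⁻¹
    convert h using 2 with t
    simp [avgAgg]

end Aggregators

theorem mainTheorem5 :
    -- aggregators given by symmetric measurable functions are counting-measurable
    (∀ (T : Type v) (S : Type w) [MeasurableSpace T] [StandardBorelSpace T]
        [MeasurableSpace S] [StandardBorelSpace S] (φ : ∀ m : ℕ, (Fin m → T) → S),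
        (∀ m, Measurable (φ m)) →
        (∀ m (t : Fin m → T) (π : Equiv.Perm (Fin m)), φ m (t ∘ π) = φ m t) →
        ∃ Φ : Aggregator T S,
          (∀ m (t : Fin m → T), Φ (Multiset.ofList (List.ofFn t)) = φ m t) ∧ Measurable Φ) ∧
    -- the group-by aggregate queries with the common aggregators are measurable
    (∀ (τ : Schema) (U : SortedUniverse.{u} τ) (R : τ.Rel) (k : ℕ) (G : Fin k ↪ τ.Col R)
        (j : τ.Col R) (B : Type u) [TopologicalSpace B] [PolishSpace B] [MeasurableSpace B]
        [BorelSpace B],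
      -- count and distinct count, for every domain of the aggregated attribute
      (∀ [NatCast B],
        Measurable (groupAggQuery U R G j (countAgg (U.dom (τ.sort R j)) B)) ∧
        Measurable (groupAggQuery U R G j (distinctCountAgg (U.dom (τ.sort R j)) B))) ∧
      -- the other aggregators, for attribute values that are read in `B` through `ν`
      (∀ ν : U.dom (τ.sort R j) → B, Measurable ν →
        (∀ [AddCommMonoid B] [ContinuousAdd B],
          Measurable (groupAggQuery U R G j fun s => sumAgg B (s.map ν))) ∧
        (∀ [LinearOrder B] [OrderClosedTopology B] (e : B),
          Measurable (groupAggQuery U R G j fun s => minAgg B e (s.map ν)) ∧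
          Measurable (groupAggQuery U R G j fun s => maxAgg B e (s.map ν))) ∧
        (∀ [AddCommMonoid B] [Module ℝ B] [ContinuousAdd B] [ContinuousConstSMul ℝ B] (e : B),
          Measurable (groupAggQuery U R G j fun s => avgAgg B e (s.map ν))))) := by
  refine ⟨?_, ?_⟩
  · intro T S _ _ _ _ φ hφ hsymm
    obtain ⟨Φ, hΦ⟩ := exists_aggregator_of_symmetric φ hsymm
    refine ⟨Φ, hΦ, measurable_of_measurable_ofFn fun m => ?_⟩
    simpa only [hΦ] using hφ m
  · intro τ U R k G j B _ _ _ _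
    refine ⟨?_, ?_⟩
    · intro _
      exact ⟨measurable_groupAggQuery U R G j measurable_countAgg,
        measurable_groupAggQuery U R G j measurable_distinctCountAgg⟩
    · intro ν hν
      -- Closedness of the order makes min and max continuous; since `B` is second countable,
      -- continuous binary operations on it are measurable for the product σ-algebra.
      refine ⟨?_, ?_, ?_⟩
      · intro _ _
        exact measurable_groupAggQuery U R G j (measurable_multiset_sum_map hν)
      · intro _ _ e
        exact ⟨measurable_groupAggQuery U R G j (measurable_minAgg hν e),
          measurable_groupAggQuery U R G j (measurable_maxAgg hν e)⟩
      · intro _ _ _ _ e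
        exact measurable_groupAggQuery U R G j (measurable_avgAgg hν e)
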